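/- Let $T,R>0$ and let $g_i(t)=\sum_{j,k}(g_i)_{jk}(t,z)\,dz_j\,dz_k$, $i=1,2$, be two smooth families ($t\in\mathbb R$) of Riemannian metrics on $\mathbb R^n$ that coincide with the Euclidean metric $g_0$ wherever $|z|\ge R$ or $|t|\ge T$. Assume that each $g_i(t)$ is non-trapping: its geodesics leave every compact subset of $\mathbb R^n$ in finite time. Write $|\zeta|^2_{g(t)}=\sum_{j,k} g^{jk}(t,z)\zeta_j\zeta_k$ for the dual metric. *Classical scattering map at the boundary.* Let ${}^{1c}T^*_{\partial\overline{\mathbb R^n}}\mathbb R^n$ be the restriction of the 1-cusp cotangent bundle of the radial compactification $\overline{\mathbb R^n}$ to its boundary; its points are $q=(y,\xi,\eta)$ with $y\in\mathbb S^{n-1}$, $\xi\in\mathbb R$, $\eta\in y^\perp\cong T^*_y\mathbb S^{n-1}$, representing the covector $\xi\,\frac{dx}{x^3}+\eta\cdot\frac{dy}{x}$ with $x=1/|Z|$, $y=Z/|Z|$. The bicharacteristics of $D_t+\Delta_{g(t)}$ at fibre infinity are the curves $(t,z(s),\hat\zeta(s))$, $s\in\mathbb R$, in a fixed time slice, with $|\hat\zeta|_{g(t)}=1$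 and $\dot z=\partial_{\zeta}|\hat\zeta|_{g(t)}^2$, $\dot{\hat\zeta}=-\partial_z|\hat\zeta|^2_{g(t)}$. Such a curve has backward (respectively forward) endpoint $q=(y,\xi,\eta)$ if, as $s\to-\infty$ (respectively $s\to+\infty$), $|z|\to\infty$, $\hat\zeta\to y$, and $z+|z|\hat\zeta\to-\eta$ (respectively $z-|z|\hat\zeta\to-\eta$), and if $\xi=-2t$. The map $\mathfrak{Cl}_g$ on ${}^{1c}T^*_{\partial\overline{\mathbb R^n}}\mathbb R^n$ sends the backward endpoint of each such bicharacteristic to its forward endpoint. *Truncated scattering relation.* Let $\partial_-\mathfrak B$ (respectively $\partial_+\mathfrak B$) be the set of $(t,z,v)$ with $t\in[-T,T]$, $|z|=R$, $|v|=1$ and $z\cdot v<0$ (respectively $z\cdot v>0$), i.e. the inward (respectively outward) boundary of $[-T,T]\times S^*B_R(0)$. For $(t,z,v)\in\partial_-\mathfrak B$ let $\mathfrak{Cl}^R_g(t,z,v)=(t,z',v')\in\partial_+\mathfrak B$, where $(z',v')$ is the point of the unit speed geodesic of $g(t)$ starting from $(z,v)$, lifted to the unit cosphere bundle, at which it reaches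 $\partial B_R(0)$ for the first time after the start. If $\mathfrak{Cl}_{g_1}=\mathfrak{Cl}_{g_2}$ on ${}^{1c}T^*_{\partial\overline{\mathbb R^n}}\mathbb R^n$, then $\mathfrak{Cl}^R_{g_1}$ and $\mathfrak{Cl}^R_{g_2}$ are well-defined maps $\partial_-\mathfrak B\to\partial_+\mathfrak B$ and $\mathfrak{Cl}^R_{g_1}=\mathfrak{Cl}^R_{g_2}$. -/

import Mathlib

open Filter Topology Set
open scoped ContDiff

noncomputable section

/-- `ℝⁿ` with its Euclidean inner product. Covectors `ζ · dz` on `ℝⁿ` are written through their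
components, so they are elements of the same space. -/
abbrev E (n : ℕ) := EuclideanSpace ℝ (Fin n)

/-- A smooth family `g(t) = ∑ gᵢⱼ(t, z) dzᵢ dzⱼ`, `t ∈ ℝ`, of Riemannian metrics on `ℝⁿ`. -/
structure MetricFamily (n : ℕ) where
  /-- the matrix `(gᵢⱼ(t, z))` -/
  coeff : ℝ → E n → Matrix (Fin n) (Fin n) ℝ
  smooth : ∀ i j, ContDiff ℝ ∞ (fun p : ℝ × E n => coeff p.1 p.2 i j)
  posDef : ∀ t z, (coeff t z).PosDef

namespace MetricFamily

variable {n : ℕ}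

/-- `g(t)` is the flat metric wherever `|z| ≥ R` or `|t| ≥ T`; thus `g - g₀` is compactly supported
in spacetime, and `R`, `T` are constants that witness it. -/
def IsFlatOutside (g : MetricFamily n) (T R : ℝ) : Prop :=
  ∀ t z, (R ≤ ‖z‖ ∨ T ≤ |t|) → g.coeff t z = 1

/-- The dual metric function `|ζ|²_{g(t)} = ∑ gⁱʲ(t, z) ζᵢ ζⱼ` on the cotangent bundle. -/
def cometric (g : MetricFamily n) (t : ℝ) (z ζ : E n) : ℝ :=
  ∑ i, ∑ j, (g.coeff t z)⁻¹ i j * ζ i * ζ j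

end MetricFamily

/-- `s ↦ (z s, ζ s)` solves Hamilton's equations `z' = ∂H/∂ζ`, `ζ' = -∂H/∂z` on `I ⊆ ℝ`. -/
def IsHamiltonCurveOn {n : ℕ} (H : E n → E n → ℝ) (I : Set ℝ) (z ζ : ℝ → E n) : Prop :=
  ∀ s ∈ I, HasDerivWithinAt z (gradient (fun w => H (z s) w) (ζ s)) I s ∧
    HasDerivWithinAt ζ (-gradient (fun x => H x (ζ s)) (z s)) I s

namespace MetricFamily

variable {n : ℕ}

/-- Unit speed geodesics of `g(t)`, lifted to the unit cosphere bundle `S^*_{g(t)} ℝⁿ`: the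
Hamilton flow of `|ζ|²_{g(t)} / 2`. -/
def IsLiftedGeodesicOn (g : MetricFamily n) (t : ℝ) (I : Set ℝ) (z ζ : ℝ → E n) : Prop :=
  IsHamiltonCurveOn (fun x w => g.cometric t x w / 2) I z ζ ∧ ∀ s ∈ I, g.cometric t (z s) (ζ s) = 1

/-- Each `g(t)` is non-trapping: its geodesics leave any compact set in finite time. -/
def NonTrapping (g : MetricFamily n) : Prop :=
  ∀ (t : ℝ) (z ζ : ℝ → E n), g.IsLiftedGeodesicOn t univ z ζ →
    ∀ K : Set (E n), IsCompact K → ∃ s > 0, z s ∉ K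

/-- Bicharacteristics, over finite points of spacetime, inside fibre infinity of the parabolically
compactified cotangent bundle of `ℝⁿ⁺¹`, for the symbol `p = τ + |ζ|²_{g(t)}` of
`D_t + Δ_{g(t)} + V`.  With `ρ = |ζ|_g⁻¹`, `τ̂ = ρ² τ`, `ζ̂ = ρ ζ` one has `ρ = 0`, `|ζ̂|_g = 1`, and
`τ̂ = -1` on the characteristic variety, and `ρ H_p` restricts to
`∂_ζ p(ζ̂) · ∂_z - ∂_z p(ζ̂) · ∂_ζ̂`; in particular `t` is constant along the flow (and `V` does not
enter).  In the definition `ζ` stands for `ζ̂`. -/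
def IsBicharacteristicAtFibreInfinity (g : MetricFamily n) (t : ℝ) (z ζ : ℝ → E n) : Prop :=
  IsHamiltonCurveOn (g.cometric t) univ z ζ ∧ ∀ s, g.cometric t (z s) (ζ s) = 1

end MetricFamily

/-- The 1-cusp cotangent bundle of the radial compactification of `ℝⁿ`, restricted to the boundary
sphere at infinity.  A point is a boundary point `y ∈ 𝕊ⁿ⁻¹` with the 1-cusp covector
`ξ dx/x³ + η · dy/x`, where `x = 1/|Z|`, `y = Z/|Z|`, and the covector `η` on the sphere is written
through `T_y^* 𝕊ⁿ⁻¹ = y^⊥ ⊆ ℝⁿ`. -/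
@[ext]
structure OneCuspBoundary (n : ℕ) where
  y : E n
  ξ : ℝ
  η : E n
  norm_y : ‖y‖ = 1
  orth : inner ℝ y η = 0

/-- The bicharacteristic `(t, z(s), ζ(s))` at fibre infinity tends, in the backward direction, to
the point `q` of the front face `W_-` of the blow-up of the source radial set
`{1/|z| = 0, t/|z| = -ρ/2, ζ/|ζ| = -z/|z|}`.  At `ρ = 0` the projective coordinates of the blow-up
along the front face are `(t/|z|)/(1/|z|) = t` and `(ζ + z/|z|)/(1/|z|) = z + |z| ζ`, and the front
face is identified with the 1-cusp cotangent bundle through `y = ζ`, `ξ = -2 t`,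
`η = - lim (z + |z| ζ)`. -/
def TendsToBackward {n : ℕ} (t : ℝ) (z ζ : ℝ → E n) (q : OneCuspBoundary n) : Prop :=
  Tendsto (fun s => ‖z s‖) atBot atTop ∧ Tendsto ζ atBot (𝓝 q.y) ∧ q.ξ = -2 * t ∧
    Tendsto (fun s => z s + ‖z s‖ • ζ s) atBot (𝓝 (-q.η))

/-- The analogue of `TendsToBackward` in the forward direction, at the front face `W_+` of the
blow-up of the sink `{1/|z| = 0, t/|z| = ρ/2, ζ/|ζ| = z/|z|}`. -/
def TendsToForward {n : ℕ} (t : ℝ) (z ζ : ℝ → E n) (q : OneCuspBoundary n) : Prop :=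
  Tendsto (fun s => ‖z s‖) atTop atTop ∧ Tendsto ζ atTop (𝓝 q.y) ∧ q.ξ = -2 * t ∧
    Tendsto (fun s => z s - ‖z s‖ • ζ s) atTop (𝓝 (-q.η))

/-- The inward part `∂₋𝔅` of the restriction to `∂B_R(0)` of `𝔅 = [-T, T] × S^*B_R(0)`; points are
`(t, z, v)`.  The metrics considered are flat over `∂B_R(0)`, so that the Euclidean norm and inner
product are used. -/
def InwardBoundary (n : ℕ) (T R : ℝ) : Set (ℝ × E n × E n) :=
  {p | p.1 ∈ Icc (-T) T ∧ ‖p.2.1‖ = R ∧ ‖p.2.2‖ = 1 ∧ inner ℝ p.2.1 p.2.2 < 0}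

/-- The outward part `∂₊𝔅`. -/
def OutwardBoundary (n : ℕ) (T R : ℝ) : Set (ℝ × E n × E n) :=
  {p | p.1 ∈ Icc (-T) T ∧ ‖p.2.1‖ = R ∧ ‖p.2.2‖ = 1 ∧ 0 < inner ℝ p.2.1 p.2.2}

namespace MetricFamily

variable {n : ℕ}

/-- The graph of the classical scattering map `Cl_g` over the boundary part of the 1-cusp cotangent
bundle: `Cl_g(q) = q'` when some bicharacteristic tends to `q` in the backward and to `q'` in the
forward direction. -/
def ClassicalScattering (g : MetricFamily n) (q q' : OneCuspBoundary n) : Prop :=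
  ∃ (t : ℝ) (z ζ : ℝ → E n), g.IsBicharacteristicAtFibreInfinity t z ζ ∧
    TendsToBackward t z ζ q ∧ TendsToForward t z ζ q'

/-- The graph of the `R`-truncated scattering relation `Cl_g^R : (t, z, v) ↦ (t, z', v')`: the unit
speed lifted geodesic of `g(t)` from `(z, v)` reaches `∂B_R(0)` for the first time at `(z', v')`
(after the length `ℓ`). -/
def TruncatedScattering (g : MetricFamily n) (T R : ℝ)
    (p : InwardBoundary n T R) (p' : OutwardBoundary n T R) : Prop :=
  p'.1.1 = p.1.1 ∧ ∃ ℓ > 0, ∃ z ζ : ℝ → E n, g.IsLiftedGeodesicOn p.1.1 (Icc 0 ℓ) z ζ ∧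
    (z 0, ζ 0) = p.1.2 ∧ (z ℓ, ζ ℓ) = p'.1.2 ∧ ∀ s ∈ Ioo 0 ℓ, ‖z s‖ < R

end MetricFamily

end

/-! The region `R ≤ ‖z‖` is Euclidean, so a geodesic entering the ball at `(z, v)` and leaving it at
`(z', v')` is a straight half-line before entry and after exit. Such a half-line has an endpoint at
infinity that records the time, the direction and the offset orthogonal to the direction. The
classical scattering map therefore relates the endpoint of the incoming line to that of the outgoing
one (`IsFlatOutside.exists_scattering`, where completeness and non-trapping provide the exit).

Conversely, a line meets the sphere going outward in at most one point, so the outgoing endpoint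
determines `(z', v')` (`eq_of_lineEndpoint_eq`). Equal scattering maps give equal outgoing
endpoints, because the backward endpoint fixes the whole geodesic up to a shift of its parameter
(`IsFlatOutside.classicalScattering_unique`). The truncated relation is single-valued by uniqueness
for the geodesic equation (`truncatedScattering_unique`). -/

/-! ### Uniqueness and global existence for autonomous differential equations -/

/-- Integral curves of a `C¹` vector field on an interval are determined by their value at one
time. -/
theorem IsIntegralCurveOn.eqOn_of_contDiff {V : Type*} [NormedAddCommGroup V] [NormedSpace ℝ V]
    [FiniteDimensional ℝ V] {X : V → V} (hX : ContDiff ℝ 1 X) {I : Set ℝ} [hI : I.OrdConnected]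
    {γ γ' : ℝ → V} (hγ : IsIntegralCurveOn γ (fun _ => X) I)
    (hγ' : IsIntegralCurveOn γ' (fun _ => X) I) {s₀ : ℝ} (hs₀ : s₀ ∈ I) (h : γ s₀ = γ' s₀) :
    EqOn γ γ' I := by
  -- Over a compact time interval both curves stay in one ball, where a `C¹` field is Lipschitz.
  have hlip : ∀ a b, Icc a b ⊆ I → ∃ (K : NNReal) (S : Set V), LipschitzOnWith K X S ∧
      ∀ t ∈ Icc a b, γ t ∈ S ∧ γ' t ∈ S := by
    intro a b hab
    have hc := (isCompact_Icc (a := a) (b := b)).image_of_continuousOn (hγ.mono hab).continuousOn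
    have hc' := (isCompact_Icc (a := a) (b := b)).image_of_continuousOn (hγ'.mono hab).continuousOn
    obtain ⟨r, hr⟩ := (hc.union hc').isBounded.subset_closedBall 0
    have : ProperSpace V := FiniteDimensional.proper ℝ V
    obtain ⟨K, hK⟩ := hX.contDiffOn.exists_lipschitzOnWith (s := Metric.closedBall 0 r) one_ne_zero
      (convex_closedBall 0 r) (isCompact_closedBall 0 r)
    exact ⟨K, _, hK, fun t ht => ⟨hr (.inl ⟨t, ht, rfl⟩), hr (.inr ⟨t, ht, rfl⟩)⟩⟩
  intro s hs
  rcases le_total s₀ s with hle | hle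
  · have hsub : Icc s₀ s ⊆ I := hI.out hs₀ hs
    obtain ⟨K, S, hK, hS⟩ := hlip _ _ hsub
    have hmem : ∀ t ∈ Ico s₀ s, Icc s₀ s ∈ 𝓝[≥] t := fun t ht => Icc_mem_nhdsGE_of_mem ht
    exact ODE_solution_unique_of_mem_Icc_right (v := fun _ => X) (s := fun _ => S)
      (fun _ _ => hK) (hγ.mono hsub).continuousOn
      (fun t ht => ((hγ.mono hsub) t (Ico_subset_Icc_self ht)).mono_of_mem_nhdsWithin (hmem t ht))
      (fun t ht => (hS t (Ico_subset_Icc_self ht)).1) (hγ'.mono hsub).continuousOn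
      (fun t ht => ((hγ'.mono hsub) t (Ico_subset_Icc_self ht)).mono_of_mem_nhdsWithin (hmem t ht))
      (fun t ht => (hS t (Ico_subset_Icc_self ht)).2) h ⟨hle, le_rfl⟩
  · have hsub : Icc s s₀ ⊆ I := hI.out hs hs₀
    obtain ⟨K, S, hK, hS⟩ := hlip _ _ hsub
    have hmem : ∀ t ∈ Ioc s s₀, Icc s s₀ ∈ 𝓝[≤] t := fun t ht => Icc_mem_nhdsLE_of_mem ht
    exact ODE_solution_unique_of_mem_Icc_left (v := fun _ => X) (s := fun _ => S)
      (fun _ _ => hK) (hγ.mono hsub).continuousOn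
      (fun t ht => ((hγ.mono hsub) t (Ioc_subset_Icc_self ht)).mono_of_mem_nhdsWithin (hmem t ht))
      (fun t ht => (hS t (Ioc_subset_Icc_self ht)).1) (hγ'.mono hsub).continuousOn
      (fun t ht => ((hγ'.mono hsub) t (Ioc_subset_Icc_self ht)).mono_of_mem_nhdsWithin (hmem t ht))
      (fun t ht => (hS t (Ioc_subset_Icc_self ht)).2) h ⟨le_rfl, hle⟩

/-- A bounded Lipschitz vector field has global integral curves. -/
theorem exists_isIntegralCurve_of_lipschitzWith {V : Type*} [NormedAddCommGroup V]
    [NormedSpace ℝ V] [CompleteSpace V] {X : V → V} {K L : NNReal} (hK : LipschitzWith K X)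
    (hL : ∀ p, ‖X p‖ ≤ L) (p₀ : V) :
    ∃ γ : ℝ → V, γ 0 = p₀ ∧ IsIntegralCurve γ (fun _ => X) := by
  have hloc : ∀ a : NNReal, ∃ γ : ℝ → V, γ 0 = p₀ ∧
      ∀ s ∈ Icc (-(a : ℝ)) a, HasDerivWithinAt γ (X (γ s)) (Icc (-(a : ℝ)) a) s := by
    intro a
    -- At speed at most `L`, a curve stays within distance `L * a` up to time `a`, so
    -- Picard–Lindelöf covers all of `[-a, a]`.
    have hpl : IsPicardLindelof (fun _ => X) (tmin := -(a : ℝ)) (tmax := a) ⟨0, by simp⟩ p₀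
        (L * a) 0 L K :=
      .of_time_independent (fun p _ => hL p) (hK.lipschitzOnWith) (by simp)
    exact hpl.exists_eq_forall_mem_Icc_hasDerivWithinAt₀
  choose γ hγ0 hγ using hloc
  have hcomp : ∀ a b : NNReal, a ≤ b → EqOn (γ a) (γ b) (Ioo (-(a : ℝ)) a) := by
    intro a b hab
    rcases eq_or_lt_of_le (zero_le (a := a)) with rfl | ha
    · intro s hs; simp at hs
    have hab' : (a : ℝ) ≤ b := hab
    refine ODE_solution_unique_of_mem_Ioo (v := fun _ => X) (s := fun _ => univ) (K := K)
      (t₀ := 0) (fun _ _ => hK.lipschitzOnWith) ⟨by simpa using ha, ha⟩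
      (fun t ht => ⟨(hγ a t (Ioo_subset_Icc_self ht)).hasDerivAt (Icc_mem_nhds ht.1 ht.2), trivial⟩)
      (fun t ht => ⟨(hγ b t ⟨by linarith [ht.1], by linarith [ht.2]⟩).hasDerivAt
        (Icc_mem_nhds (by linarith [ht.1]) (by linarith [ht.2])), trivial⟩) (by rw [hγ0, hγ0])
  -- Local solutions are glued diagonally; the extra 1 puts `s` in the interior of the interval
  -- used. Within distance 1 of `s`, all of them agree with the solution for `|s| + 2`.
  refine ⟨fun s => γ (‖s‖₊ + 1) s, hγ0 _, fun s => ?_⟩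
  set b : NNReal := ‖s‖₊ + 2 with hb
  have hbc : (b : ℝ) = |s| + 2 := by simp [hb]
  have hs := abs_le.1 (le_refl |s|)
  have hev : (fun u => γ (‖u‖₊ + 1) u) =ᶠ[𝓝 s] γ b := by
    filter_upwards [Metric.ball_mem_nhds s one_pos] with u hu
    rw [Metric.mem_ball, Real.dist_eq] at hu
    have h1 : |u| ≤ |s| + 1 := by
      have := abs_sub_abs_le_abs_sub u s
      linarith
    refine hcomp _ _ ?_ ?_
    · rw [← NNReal.coe_le_coe, hbc]
      simp only [NNReal.coe_add, coe_nnnorm, Real.norm_eq_abs, NNReal.coe_one]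
      linarith
    · have := abs_le.1 (le_refl |u|)
      simp only [NNReal.coe_add, coe_nnnorm, Real.norm_eq_abs, NNReal.coe_one]
      constructor <;> linarith
  have hd := (hγ b s ⟨by linarith, by linarith⟩).hasDerivAt
    (Icc_mem_nhds (by linarith) (by linarith))
  have h := hd.congr_of_eventuallyEq hev
  rwa [← hev.eq_of_nhds] at h

/-! ### Hamilton vector fields -/

/-- The Hamilton vector field `(∂H/∂ζ, -∂H/∂z)` on the cotangent bundle of `ℝⁿ`. -/
noncomputable def hamiltonField {n : ℕ} (H : E n → E n → ℝ) (p : E n × E n) : E n × E n :=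
  (gradient (fun w => H p.1 w) p.2, -gradient (fun x => H x p.2) p.1)

theorem isHamiltonCurveOn_iff {n : ℕ} {H : E n → E n → ℝ} {I : Set ℝ} {z ζ : ℝ → E n} :
    IsHamiltonCurveOn H I z ζ ↔
      IsIntegralCurveOn (fun s => (z s, ζ s)) (fun _ => hamiltonField H) I := by
  refine forall₂_congr fun s _ => ⟨fun h => h.1.prodMk h.2, fun h => ⟨?_, ?_⟩⟩
  · exact (hasFDerivAt_fst (p := (z s, ζ s))).comp_hasDerivWithinAt s h
  · exact (hasFDerivAt_snd (p := (z s, ζ s))).comp_hasDerivWithinAt s h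

section HamiltonField

variable {n : ℕ} {H : E n → E n → ℝ}

theorem inner_gradient_snd (hH : Differentiable ℝ fun p : E n × E n => H p.1 p.2)
    (p : E n × E n) (v : E n) : inner ℝ (gradient (fun w => H p.1 w) p.2) v =
      fderiv ℝ (fun p : E n × E n => H p.1 p.2) p (0, v) := by
  have h : HasFDerivAt (fun w => H p.1 w)
      ((fderiv ℝ (fun p : E n × E n => H p.1 p.2) p).comp (.inr ℝ (E n) (E n))) p.2 :=
    HasFDerivAt.comp (g := fun p : E n × E n => H p.1 p.2) p.2
      (f := fun w => (p.1, w)) (hH p).hasFDerivAt (hasFDerivAt_prodMk_right p.1 p.2)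
  rw [gradient, InnerProductSpace.toDual_symm_apply, h.fderiv]
  simp

theorem inner_gradient_fst (hH : Differentiable ℝ fun p : E n × E n => H p.1 p.2)
    (p : E n × E n) (v : E n) : inner ℝ (gradient (fun x => H x p.2) p.1) v =
      fderiv ℝ (fun p : E n × E n => H p.1 p.2) p (v, 0) := by
  have h : HasFDerivAt (fun x => H x p.2)
      ((fderiv ℝ (fun p : E n × E n => H p.1 p.2) p).comp (.inl ℝ (E n) (E n))) p.1 :=
    HasFDerivAt.comp (g := fun p : E n × E n => H p.1 p.2) p.1
      (f := fun x => (x, p.2)) (hH p).hasFDerivAt (hasFDerivAt_prodMk_left p.1 p.2)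
  rw [gradient, InnerProductSpace.toDual_symm_apply, h.fderiv]
  simp

theorem contDiff_hamiltonField (hH : ContDiff ℝ ∞ fun p : E n × E n => H p.1 p.2) :
    ContDiff ℝ ∞ (hamiltonField H) := by
  have hd : Differentiable ℝ fun p : E n × E n => H p.1 p.2 := hH.differentiable (by simp)
  have hf : ContDiff ℝ ∞ (fderiv ℝ fun p : E n × E n => H p.1 p.2) :=
    hH.fderiv_right (by simp)
  refine ContDiff.prodMk ?_ (ContDiff.neg ?_) <;> refine contDiff_euclidean.2 fun i => ?_
  · have heq : (fun p : E n × E n => (gradient (fun w => H p.1 w) p.2) i) = fun p =>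
        fderiv ℝ (fun p : E n × E n => H p.1 p.2) p ((0 : E n), EuclideanSpace.single i (1 : ℝ)) := by
      ext p
      rw [← inner_gradient_snd hd, EuclideanSpace.inner_single_right]
      simp
    exact heq ▸ hf.clm_apply contDiff_const
  · have heq : (fun p : E n × E n => (gradient (fun x => H x p.2) p.1) i) = fun p =>
        fderiv ℝ (fun p : E n × E n => H p.1 p.2) p (EuclideanSpace.single i (1 : ℝ), (0 : E n)) := by
      ext p
      rw [← inner_gradient_fst hd, EuclideanSpace.inner_single_right]
      simp
    exact heq ▸ hf.clm_apply contDiff_const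

/-- The two terms are `±⟨∂H/∂z, ∂H/∂ζ⟩` and cancel. -/
theorem fderiv_hamiltonField (hH : Differentiable ℝ fun p : E n × E n => H p.1 p.2)
    (p : E n × E n) : fderiv ℝ (fun p : E n × E n => H p.1 p.2) p (hamiltonField H p) = 0 := by
  have : hamiltonField H p = (gradient (fun w => H p.1 w) p.2, 0) +
      (0, -gradient (fun x => H x p.2) p.1) := by simp [hamiltonField]
  rw [this, map_add, ← inner_gradient_fst hH, ← inner_gradient_snd hH, inner_neg_right,
    real_inner_comm, add_neg_cancel]

/-- The Hamiltonian is constant along the integral curves of any multiple of its Hamilton field. -/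
theorem hamiltonian_conserved (hH : Differentiable ℝ fun p : E n × E n => H p.1 p.2)
    {χ : E n × E n → ℝ} {γ : ℝ → E n × E n}
    (hγ : IsIntegralCurve γ (fun _ p => χ p • hamiltonField H p)) (s s' : ℝ) :
    H (γ s).1 (γ s).2 = H (γ s').1 (γ s').2 := by
  have h : ∀ s, HasDerivAt (fun s => H (γ s).1 (γ s).2) 0 s := fun s => by
    have := (hH (γ s)).hasFDerivAt.comp_hasDerivAt s (hγ s)
    rwa [map_smul, fderiv_hamiltonField hH, smul_zero] at this
  exact is_const_of_deriv_eq_zero (fun s => (h s).differentiableAt) (fun s => (h s).deriv) s s'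

end HamiltonField

/-! ### The geodesic field and its completeness -/

namespace MetricFamily

variable {n : ℕ} (g : MetricFamily n) (t : ℝ)

theorem contDiff_coeff (i j : Fin n) : ContDiff ℝ ∞ fun z => g.coeff t z i j :=
  (g.smooth i j).comp (contDiff_const.prodMk contDiff_id)

/-- Cramer's rule: the entries are cofactors, polynomial in the coefficients, over a positive
determinant. -/
theorem contDiff_inv_coeff (i j : Fin n) : ContDiff ℝ ∞ fun z => (g.coeff t z)⁻¹ i j := by
  have hdet : ∀ A : E n → Matrix (Fin n) (Fin n) ℝ, (∀ i j, ContDiff ℝ ∞ fun z => A z i j) →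
      ContDiff ℝ ∞ fun z => (A z).det := by
    intro A hA
    simp only [Matrix.det_apply]
    exact ContDiff.sum fun σ _ => (contDiff_prod fun i _ => hA _ _).const_smul _
  simp only [Matrix.inv_def, Ring.inverse_eq_inv', Matrix.smul_apply, smul_eq_mul,
    Matrix.adjugate_apply]
  refine ContDiff.mul (ContDiff.inv (hdet _ (g.contDiff_coeff t))
    fun z => (g.posDef t z).det_pos.ne') (hdet _ fun k l => ?_)
  by_cases hk : k = j
  · subst hk
    simpa using contDiff_const
  · simpa [Matrix.updateRow_ne hk] using g.contDiff_coeff t k l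

theorem contDiff_cometric : ContDiff ℝ ∞ fun p : E n × E n => g.cometric t p.1 p.2 := by
  have hc : ∀ i, ContDiff ℝ ∞ fun p : E n × E n => p.2 i := fun i =>
    contDiff_euclidean.1 contDiff_snd i
  exact ContDiff.sum fun i _ => ContDiff.sum fun j _ =>
    (((g.contDiff_inv_coeff t i j).comp contDiff_fst).mul (hc i)).mul (hc j)

theorem contDiff_half_cometric :
    ContDiff ℝ ∞ fun p : E n × E n => g.cometric t p.1 p.2 / 2 :=
  (g.contDiff_cometric t).div_const 2

/-- The generator of the geodesic flow of `g(t)` on the cotangent bundle. -/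
noncomputable def geodesicField : E n × E n → E n × E n :=
  hamiltonField fun x w => g.cometric t x w / 2

theorem contDiff_geodesicField : ContDiff ℝ ∞ (g.geodesicField t) :=
  contDiff_hamiltonField (g.contDiff_half_cometric t)

theorem cometric_smul (c : ℝ) (z ζ : E n) :
    g.cometric t z (c • ζ) = c ^ 2 * g.cometric t z ζ := by
  simp only [cometric, PiLp.smul_apply, smul_eq_mul, Finset.mul_sum]
  exact Finset.sum_congr rfl fun i _ => Finset.sum_congr rfl fun j _ => by ring

theorem cometric_pos {z ζ : E n} (hζ : ζ ≠ 0) : 0 < g.cometric t z ζ := by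
  have h := (g.posDef t z).inv.dotProduct_mulVec_pos (x := ζ.ofLp) (by simpa using hζ)
  refine h.trans_eq ?_
  simp only [cometric, dotProduct, Matrix.mulVec, Finset.mul_sum, star_trivial]
  exact Finset.sum_congr rfl fun i _ => Finset.sum_congr rfl fun j _ => by ring

variable {g} {T R : ℝ}

theorem IsFlatOutside.cometric_eq (h : g.IsFlatOutside T R) {z : E n} (hz : R ≤ ‖z‖) (ζ : E n) :
    g.cometric t z ζ = ‖ζ‖ ^ 2 := by
  rw [EuclideanSpace.norm_sq_eq]
  simp [cometric, h t z (.inl hz), Matrix.one_apply, sq]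

/-- Over the region where the metric is flat, the geodesic flow is generated by `ζ · ∂_z`. -/
theorem IsFlatOutside.geodesicField_eq (h : g.IsFlatOutside T R) (hR : 0 < R) {p : E n × E n}
    (hp : R ≤ ‖p.1‖) : g.geodesicField t p = (p.2, 0) := by
  have hopen : ∀ q : E n × E n, R < ‖q.1‖ → g.geodesicField t q = (q.2, 0) := by
    intro q hq
    have h1 : (fun w => g.cometric t q.1 w / 2) = fun w => ‖w‖ ^ 2 / 2 := by
      ext w; rw [h.cometric_eq t hq.le]
    have h2 : (fun x => g.cometric t x q.2 / 2) =ᶠ[𝓝 q.1] fun _ => ‖q.2‖ ^ 2 / 2 := by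
      filter_upwards [(isOpen_lt continuous_const continuous_norm).mem_nhds hq] with x hx
      rw [h.cometric_eq t (le_of_lt hx)]
    have h3 : gradient (fun w : E n => ‖w‖ ^ 2 / 2) q.2 = q.2 := by
      have : HasGradientAt (fun w : E n => ‖w‖ ^ 2 / 2) q.2 q.2 := by
        rw [hasGradientAt_iff_hasFDerivAt]
        have := (hasStrictFDerivAt_norm_sq q.2).hasFDerivAt.mul_const (1 / 2 : ℝ)
        simp only [mul_one_div] at this
        refine this.congr_fderiv (ContinuousLinearMap.ext fun v => ?_)
        simp
      exact this.gradient
    have h4 : gradient (fun x => g.cometric t x q.2 / 2) q.1 = 0 := by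
      rw [gradient, h2.fderiv_eq]
      simp
    rw [geodesicField, hamiltonField, h1, h3, h4, neg_zero]
  have hp0 : 0 < ‖p.1‖ := hR.trans_le hp
  -- The gradient in `z` needs flatness on a neighbourhood, which fails on the sphere `‖z‖ = R`.
  -- There the field is obtained by continuity along the ray, letting `r` decrease to 1.
  have hcl : IsClosed {r : ℝ | g.geodesicField t (r • p.1, p.2) = (p.2, 0)} :=
    isClosed_eq ((g.contDiff_geodesicField t).continuous.comp (by fun_prop)) continuous_const
  have hsub : Ioi (1 : ℝ) ⊆ {r : ℝ | g.geodesicField t (r • p.1, p.2) = (p.2, 0)} := by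
    intro r hr
    refine hopen _ ?_
    rw [norm_smul, Real.norm_eq_abs, abs_of_pos (one_pos.trans hr)]
    nlinarith [mem_Ioi.1 hr]
  have : (1 : ℝ) ∈ {r : ℝ | g.geodesicField t (r • p.1, p.2) = (p.2, 0)} :=
    hcl.closure_subset_iff.2 hsub (by simp)
  simpa using this

/-- The metrics that are flat outside a ball are uniformly equivalent to the flat one. -/
theorem IsFlatOutside.exists_norm_le (h : g.IsFlatOutside T R) :
    ∃ M : ℝ, ∀ z ζ : E n, g.cometric t z ζ = 1 → ‖ζ‖ ≤ M := by
  have hcomp : IsCompact (Metric.closedBall (0 : E n) R ×ˢ Metric.sphere (0 : E n) 1) :=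
    (isCompact_closedBall _ _).prod (isCompact_sphere _ _)
  have hcont : ContinuousOn (fun p : E n × E n => (g.cometric t p.1 p.2)⁻¹)
      (Metric.closedBall (0 : E n) R ×ˢ Metric.sphere (0 : E n) 1) := by
    refine (g.contDiff_cometric t).continuous.continuousOn.inv₀ fun p hp => ?_
    refine (g.cometric_pos t fun h0 => ?_).ne'
    have := hp.2
    simp [h0] at this
  obtain ⟨C, hC⟩ := hcomp.exists_bound_of_continuousOn hcont
  -- Where the metric is flat, `‖ζ‖ = 1`; over the ball, homogeneity gives `‖ζ‖ ^ 2 ≤ C`.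
  refine ⟨max 1 (C + 1), fun z ζ hζ => ?_⟩
  rcases le_total R ‖z‖ with hz | hz
  · rw [h.cometric_eq t hz] at hζ
    refine le_max_of_le_left ?_
    nlinarith [norm_nonneg ζ]
  · refine le_max_of_le_right ?_
    rcases eq_or_ne ζ 0 with rfl | h0
    · simp [cometric] at hζ
    have hn : 0 < ‖ζ‖ := norm_pos_iff.2 h0
    have hb := hC (z, ‖ζ‖⁻¹ • ζ) ⟨by simpa using hz, by simp [norm_smul, hn.ne']⟩
    simp only [cometric_smul, hζ, mul_one, inv_pow, inv_inv, norm_pow, norm_norm] at hb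
    nlinarith [sq_nonneg (‖ζ‖ - 1)]

/-- Lifted geodesics exist for all times. -/
theorem IsFlatOutside.exists_isLiftedGeodesicOn_univ (h : g.IsFlatOutside T R) (hR : 0 < R)
    {z₀ ζ₀ : E n} (h₀ : g.cometric t z₀ ζ₀ = 1) :
    ∃ z ζ : ℝ → E n, z 0 = z₀ ∧ ζ 0 = ζ₀ ∧ g.IsLiftedGeodesicOn t univ z ζ := by
  obtain ⟨M, hM⟩ := h.exists_norm_le t
  -- The cutoff in `ζ` is 1 on all unit covectors. It makes the field bounded and Lipschitz, and
  -- since the cut-off flow still conserves the Hamiltonian, the curve never sees the cutoff.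
  let χ : ContDiffBump (0 : E n) := ⟨max M 0 + 1, max M 0 + 2, by positivity, by linarith⟩
  have hX := g.contDiff_geodesicField t
  have hχ : ContDiff ℝ ∞ χ := χ.contDiff
  have hc1 : ContDiff ℝ ∞ fun w : E n => χ w • (w, (0 : E n)) :=
    hχ.smul (contDiff_id.prodMk contDiff_const)
  have hs1 : HasCompactSupport fun w : E n => χ w • (w, (0 : E n)) :=
    χ.hasCompactSupport.smul_right
  have hc2 : ContDiff ℝ ∞ fun p : E n × E n => χ p.2 • (g.geodesicField t p - (p.2, 0)) :=
    (hχ.comp contDiff_snd).smul (hX.sub (contDiff_snd.prodMk contDiff_const))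
  have hs2 : HasCompactSupport
      fun p : E n × E n => χ p.2 • (g.geodesicField t p - (p.2, 0)) := by
    refine HasCompactSupport.intro ((isCompact_closedBall (0 : E n) R).prod
      χ.hasCompactSupport.isCompact) fun p hp => ?_
    by_cases hz : R ≤ ‖p.1‖
    · simp [h.geodesicField_eq t hR hz]
    · have : p.2 ∉ tsupport χ := fun hm => hp ⟨by simpa using (not_le.1 hz).le, hm⟩
      rw [image_eq_zero_of_notMem_tsupport this, zero_smul]
  obtain ⟨K1, hK1⟩ := hc1.lipschitzWith_of_hasCompactSupport hs1 (by simp)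
  obtain ⟨K2, hK2⟩ := hc2.lipschitzWith_of_hasCompactSupport hs2 (by simp)
  obtain ⟨L1, hL1⟩ := hs1.exists_bound_of_continuous hc1.continuous
  obtain ⟨L2, hL2⟩ := hs2.exists_bound_of_continuous hc2.continuous
  -- Neither the cut-off field nor its flat part has compact support in `(z, ζ)`, but the flat part
  -- depends on `ζ` alone, and the remainder lives over the ball.
  have hsum : (fun p : E n × E n => χ p.2 • g.geodesicField t p) =
      fun p => χ p.2 • (p.2, (0 : E n)) + χ p.2 • (g.geodesicField t p - (p.2, 0)) := by
    ext1 p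
    rw [← smul_add, add_sub_cancel]
  have hK : LipschitzWith (K1 * 1 + K2) fun p : E n × E n => χ p.2 • g.geodesicField t p := by
    rw [hsum]
    exact (hK1.comp LipschitzWith.prod_snd).add hK2
  have hL : ∀ p : E n × E n, ‖χ p.2 • g.geodesicField t p‖ ≤ (L1 + L2).toNNReal := fun p => by
    rw [congrFun hsum p]
    exact (norm_add_le _ _).trans ((add_le_add (hL1 _) (hL2 _)).trans (Real.le_coe_toNNReal _))
  obtain ⟨γ, hγ0, hγ⟩ := exists_isIntegralCurve_of_lipschitzWith hK hL (z₀, ζ₀)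
  have hone : ∀ s, g.cometric t (γ s).1 (γ s).2 = 1 := fun s => by
    have := hamiltonian_conserved ((g.contDiff_half_cometric t).differentiable (by simp))
      (χ := fun p => χ p.2) hγ s 0
    rw [hγ0, h₀] at this
    linarith
  refine ⟨fun s => (γ s).1, fun s => (γ s).2, by simp [hγ0], by simp [hγ0], ?_, fun s _ => hone s⟩
  rw [isHamiltonCurveOn_iff]
  refine fun s _ => ?_
  have hs : HasDerivAt γ (χ (γ s).2 • g.geodesicField t (γ s)) s := hγ s
  rw [χ.one_of_mem_closedBall, one_smul] at hs
  · exact hs.hasDerivWithinAt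
  · simp only [mem_closedBall_zero_iff]
    exact (hM _ _ (hone s)).trans ((le_max_left M 0).trans (le_add_of_nonneg_right zero_le_one))

end MetricFamily

/-! ### Straight lines and their endpoints at infinity -/

theorem TendsToBackward.comp {n : ℕ} {t : ℝ} {z ζ : ℝ → E n} {q : OneCuspBoundary n}
    (h : TendsToBackward t z ζ q) {φ : ℝ → ℝ} (hφ : Tendsto φ atBot atBot) :
    TendsToBackward t (z ∘ φ) (ζ ∘ φ) q :=
  ⟨h.1.comp hφ, h.2.1.comp hφ, h.2.2.1, h.2.2.2.comp hφ⟩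

theorem TendsToForward.comp {n : ℕ} {t : ℝ} {z ζ : ℝ → E n} {q : OneCuspBoundary n}
    (h : TendsToForward t z ζ q) {φ : ℝ → ℝ} (hφ : Tendsto φ atTop atTop) :
    TendsToForward t (z ∘ φ) (ζ ∘ φ) q :=
  ⟨h.1.comp hφ, h.2.1.comp hφ, h.2.2.1, h.2.2.2.comp hφ⟩

theorem TendsToForward.unique {n : ℕ} {t : ℝ} {z ζ : ℝ → E n} {q q' : OneCuspBoundary n}
    (hleft : TendsToForward t z ζ q) (hright : TendsToForward t z ζ q') : q = q' :=
  OneCuspBoundary.ext (tendsto_nhds_unique hleft.2.1 hright.2.1) (hleft.2.2.1.trans hright.2.2.1.symm)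
    (neg_injective (tendsto_nhds_unique hleft.2.2.2 hright.2.2.2))

/-- The endpoint at infinity of a line `z + ℝ v` at time `t`. -/
noncomputable def lineEndpoint {n : ℕ} (t : ℝ) (z v : E n) (hv : ‖v‖ = 1) : OneCuspBoundary n where
  y := v
  ξ := -2 * t
  η := -(z - inner ℝ z v • v)
  norm_y := hv
  orth := by
    rw [inner_neg_right, inner_sub_right, inner_smul_right, real_inner_self_eq_norm_sq, hv,
      real_inner_comm]
    simp

section Lines

variable {F : Type*} [NormedAddCommGroup F] [InnerProductSpace ℝ F] {z v : F}

theorem norm_add_smul_sq_of_norm_eq_one (hv : ‖v‖ = 1) (s : ℝ) :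
    ‖z + s • v‖ ^ 2 = ‖z‖ ^ 2 + 2 * s * inner ℝ z v + s ^ 2 := by
  rw [norm_add_sq_real, inner_smul_right, norm_smul, hv, Real.norm_eq_abs, mul_one, sq_abs]
  ring

theorem le_norm_add_smul (hv : ‖v‖ = 1) {s : ℝ} (h : 0 ≤ s * inner ℝ z v) :
    ‖z‖ ≤ ‖z + s • v‖ := by
  refine le_of_sq_le_sq ?_ (norm_nonneg _)
  rw [norm_add_smul_sq_of_norm_eq_one hv]
  nlinarith [sq_nonneg s]

theorem tendsto_norm_line (hv : ‖v‖ = 1) : Tendsto (fun s : ℝ => ‖z + s • v‖) atTop atTop := by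
  refine tendsto_atTop_mono (fun s => ?_) (tendsto_atTop_add_const_right atTop (-‖z‖) tendsto_id)
  have h1 : ‖s • v‖ ≤ ‖z + s • v‖ + ‖z‖ := by
    simpa [add_comm] using norm_sub_le (z + s • v) z
  rw [norm_smul, hv, mul_one, Real.norm_eq_abs] at h1
  simp only [id]
  linarith [le_abs_self s]

theorem tendsto_line_sub (hv : ‖v‖ = 1) :
    Tendsto (fun s : ℝ => (z + s • v) - ‖z + s • v‖ • v) atTop (𝓝 (z - inner ℝ z v • v)) := by
  set a : ℝ := inner ℝ z v with ha
  have hden : Tendsto (fun s : ℝ => ‖z + s • v‖ + (s + a)) atTop atTop :=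
    (tendsto_norm_line hv).atTop_add_atTop (tendsto_atTop_add_const_right _ a tendsto_id)
  -- Rationalising, `(‖z + s • v‖ - (s + a)) * (‖z + s • v‖ + (s + a)) = ‖z‖ ^ 2 - a ^ 2` does not
  -- depend on `s`.
  have hlim : Tendsto (fun s : ℝ => ‖z + s • v‖ - s) atTop (𝓝 a) := by
    have h0 : Tendsto (fun s : ℝ => (‖z‖ ^ 2 - a ^ 2) / (‖z + s • v‖ + (s + a)) + a) atTop
        (𝓝 (0 + a)) := (hden.const_div_atTop _).add_const a
    rw [zero_add] at h0
    refine h0.congr' ?_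
    filter_upwards [hden.eventually_gt_atTop 0] with s hs
    have := norm_add_smul_sq_of_norm_eq_one (z := z) hv s
    rw [← ha] at this
    field_simp
    linear_combination -this
  have := (tendsto_const_nhds (x := z)).sub (hlim.smul_const v)
  refine this.congr fun s => ?_
  rw [sub_smul]
  abel

theorem tendsto_line_add (hv : ‖v‖ = 1) :
    Tendsto (fun s : ℝ => (z + s • v) + ‖z + s • v‖ • v) atBot (𝓝 (z - inner ℝ z v • v)) := by
  have := (tendsto_line_sub (z := z) (v := -v) (by rwa [norm_neg])).comp tendsto_neg_atBot_atTop
  simpa [Function.comp_def] using this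

end Lines

theorem tendsToForward_of_line {n : ℕ} {t s₀ : ℝ} {z ζ : ℝ → E n} {c v : E n} (hv : ‖v‖ = 1)
    (h : ∀ s ≥ s₀, z s = c + s • v ∧ ζ s = v) : TendsToForward t z ζ (lineEndpoint t c v hv) := by
  have he : ∀ᶠ s in atTop, c + s • v = z s ∧ v = ζ s := by
    filter_upwards [eventually_ge_atTop s₀] with s hs using ⟨(h s hs).1.symm, (h s hs).2.symm⟩
  refine ⟨(tendsto_norm_line (z := c) hv).congr' ?_, (tendsto_const_nhds (x := v)).congr' ?_, rfl, ?_⟩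
  · filter_upwards [he] with s hs using by rw [hs.1]
  · filter_upwards [he] with s hs using hs.2
  · rw [lineEndpoint, neg_neg]
    refine (tendsto_line_sub hv).congr' ?_
    filter_upwards [he] with s hs
    rw [hs.1, ← hs.2]

theorem tendsToBackward_of_line {n : ℕ} {t s₀ : ℝ} {z ζ : ℝ → E n} {c v : E n} (hv : ‖v‖ = 1)
    (h : ∀ s ≤ s₀, z s = c + s • v ∧ ζ s = v) : TendsToBackward t z ζ (lineEndpoint t c v hv) := by
  have he : ∀ᶠ s in atBot, c + s • v = z s ∧ v = ζ s := by
    filter_upwards [eventually_le_atBot s₀] with s hs using ⟨(h s hs).1.symm, (h s hs).2.symm⟩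
  refine ⟨?_, (tendsto_const_nhds (x := v)).congr' ?_, rfl, ?_⟩
  · have := (tendsto_norm_line (z := c) (v := -v) (by rwa [norm_neg])).comp tendsto_neg_atBot_atTop
    refine this.congr' ?_
    filter_upwards [he] with s hs
    simp [← hs.1]
  · filter_upwards [he] with s hs using hs.2
  · rw [lineEndpoint, neg_neg]
    refine (tendsto_line_add hv).congr' ?_
    filter_upwards [he] with s hs
    rw [hs.1, ← hs.2]

/-- A line that leaves the ball `B_R(0)` at `z` is determined by its endpoint at infinity. -/
theorem eq_of_lineEndpoint_eq {n : ℕ} {t t' R : ℝ} {z z' v v' : E n} {hv : ‖v‖ = 1}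
    {hv' : ‖v'‖ = 1} (hz : ‖z‖ = R) (hz' : ‖z'‖ = R) (hpos : 0 < inner ℝ z v)
    (hpos' : 0 < inner ℝ z' v') (h : lineEndpoint t z v hv = lineEndpoint t' z' v' hv') :
    z = z' ∧ v = v' := by
  have hy : v = v' := congrArg OneCuspBoundary.y h
  subst hy
  refine ⟨?_, rfl⟩
  have hη : z - inner ℝ z v • v = z' - inner ℝ z' v • v :=
    neg_injective (congrArg OneCuspBoundary.η h)
  have hsq : ∀ w : E n, ‖w - inner ℝ w v • v‖ ^ 2 = ‖w‖ ^ 2 - inner ℝ w v ^ 2 := fun w => by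
    rw [sub_eq_add_neg, ← neg_smul, norm_add_smul_sq_of_norm_eq_one hv]
    ring
  have h1 := hsq z
  rw [hη, hsq, hz, hz'] at h1
  -- By Pythagoras the squares agree; outwardness of both vectors fixes the sign.
  have h2 : inner ℝ z v = inner ℝ z' v := by
    have : (inner ℝ z v - inner ℝ z' v : ℝ) * (inner ℝ z v + inner ℝ z' v) = 0 := by linarith
    rcases mul_eq_zero.1 this with h | h <;> linarith
  rw [h2] at hη
  exact sub_left_injective hη

/-! ### Geodesics and the two scattering relations -/

namespace MetricFamily

variable {n : ℕ} {g : MetricFamily n} {t T R : ℝ} {I : Set ℝ} {z ζ z' ζ' : ℝ → E n}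

theorem IsLiftedGeodesicOn.isIntegralCurveOn (h : g.IsLiftedGeodesicOn t I z ζ) :
    IsIntegralCurveOn (fun s => (z s, ζ s)) (fun _ => g.geodesicField t) I :=
  isHamiltonCurveOn_iff.1 h.1

theorem IsLiftedGeodesicOn.mono (h : g.IsLiftedGeodesicOn t I z ζ) {J : Set ℝ} (hJ : J ⊆ I) :
    g.IsLiftedGeodesicOn t J z ζ :=
  ⟨isHamiltonCurveOn_iff.2 (h.isIntegralCurveOn.mono hJ), fun s hs => h.2 s (hJ hs)⟩

theorem IsLiftedGeodesicOn.eqOn [I.OrdConnected] (h : g.IsLiftedGeodesicOn t I z ζ)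
    (h' : g.IsLiftedGeodesicOn t I z' ζ') {s₀ : ℝ} (hs₀ : s₀ ∈ I)
    (h₀ : (z s₀, ζ s₀) = (z' s₀, ζ' s₀)) : ∀ s ∈ I, (z s, ζ s) = (z' s, ζ' s) :=
  h.isIntegralCurveOn.eqOn_of_contDiff ((g.contDiff_geodesicField t).of_le (by simp))
    h'.isIntegralCurveOn hs₀ h₀

theorem hasDerivAt_line {F : Type*} [NormedAddCommGroup F] [NormedSpace ℝ F] (c v : F)
    (s₀ s : ℝ) : HasDerivAt (fun s : ℝ => (c + (s - s₀) • v, v)) (v, (0 : F)) s := by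
  have h1 : HasDerivAt (fun s : ℝ => c + (s - s₀) • v) v s := by
    simpa using (((hasDerivAt_id s).sub_const s₀).smul_const v).const_add c
  exact h1.prodMk (hasDerivAt_const s v)

/-- A geodesic is a straight line as long as it stays in the flat region. -/
theorem IsLiftedGeodesicOn.eq_line_of_outside [I.OrdConnected] (h : g.IsLiftedGeodesicOn t I z ζ)
    (hflat : g.IsFlatOutside T R) (hR : 0 < R) (hout : ∀ s ∈ I, R ≤ ‖z s‖) {s₀ : ℝ}
    (hs₀ : s₀ ∈ I) : ∀ s ∈ I, z s = z s₀ + (s - s₀) • ζ s₀ ∧ ζ s = ζ s₀ := by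
  let X : E n × E n → E n × E n := fun p => (p.2, 0)
  have hX : ContDiff ℝ 1 X := contDiff_snd.prodMk contDiff_const
  have h1 : IsIntegralCurveOn (fun s => (z s, ζ s)) (fun _ => X) I := fun s hs => by
    have := h.isIntegralCurveOn s hs
    simp only [hflat.geodesicField_eq t hR (p := (z s, ζ s)) (hout s hs)] at this
    exact this
  have h2 : IsIntegralCurveOn (fun s => (z s₀ + (s - s₀) • ζ s₀, ζ s₀)) (fun _ => X) I :=
    fun s _ => (hasDerivAt_line (z s₀) (ζ s₀) s₀ s).hasDerivWithinAt
  intro s hs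
  exact Prod.ext_iff.1 (h1.eqOn_of_contDiff hX h2 hs₀ (by simp) hs)

/-- A straight line in the flat region is a geodesic. -/
theorem IsLiftedGeodesicOn.eq_line_of_line_outside [I.OrdConnected]
    (h : g.IsLiftedGeodesicOn t I z ζ) (hflat : g.IsFlatOutside T R) (hR : 0 < R) {s₀ : ℝ}
    (hs₀ : s₀ ∈ I) (hout : ∀ s ∈ I, R ≤ ‖z s₀ + (s - s₀) • ζ s₀‖) :
    ∀ s ∈ I, z s = z s₀ + (s - s₀) • ζ s₀ ∧ ζ s = ζ s₀ := by
  have h2 : IsIntegralCurveOn (fun s => (z s₀ + (s - s₀) • ζ s₀, ζ s₀))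
      (fun _ => g.geodesicField t) I := fun s hs => by
    have := (hasDerivAt_line (z s₀) (ζ s₀) s₀ s).hasDerivWithinAt (s := I)
    rwa [← hflat.geodesicField_eq t hR
      (p := (z s₀ + (s - s₀) • ζ s₀, ζ s₀)) (hout s hs)] at this
  intro s hs
  exact Prod.ext_iff.1 (h.isIntegralCurveOn.eqOn_of_contDiff
    ((g.contDiff_geodesicField t).of_le (by simp)) h2 hs₀ (by simp) hs)

theorem hamiltonField_cometric : hamiltonField (g.cometric t) = (2 : ℝ) • g.geodesicField t := by
  have hhalf : ∀ (f : E n → ℝ) (x : E n),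
      gradient f x = (2 : ℝ) • gradient (fun w => f w / 2) x := by
    intro f x
    have : f = (2 : ℝ) • fun w => f w / 2 := by
      ext w
      simp only [Pi.smul_apply, smul_eq_mul]
      ring
    conv_lhs => rw [this]
    rw [gradient, fderiv_const_smul_field, Pi.smul_apply, map_smulₛₗ]
    rfl
  ext1 p
  simp only [hamiltonField, geodesicField, Pi.smul_apply, Prod.smul_mk, smul_neg]
  rw [hhalf, hhalf (fun x => g.cometric t x p.2)]

/-- The scattering map in terms of unit speed geodesics, which are the bicharacteristics
traversed at half the speed. -/
theorem classicalScattering_iff {q q' : OneCuspBoundary n} : g.ClassicalScattering q q' ↔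
    ∃ (t : ℝ) (z ζ : ℝ → E n), g.IsLiftedGeodesicOn t univ z ζ ∧
      TendsToBackward t z ζ q ∧ TendsToForward t z ζ q' := by
  have hbot : ∀ {a : ℝ}, 0 < a → Tendsto (· * a) atBot atBot := fun ha =>
    tendsto_id.atBot_mul_const ha
  have htop : ∀ {a : ℝ}, 0 < a → Tendsto (· * a) atTop atTop := fun ha =>
    tendsto_id.atTop_mul_const ha
  constructor
  · rintro ⟨t, z, ζ, ⟨h, h1⟩, hb, hf⟩
    refine ⟨t, _, _, ⟨isHamiltonCurveOn_iff.2 ?_, fun s _ => h1 (s * 2⁻¹)⟩,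
      hb.comp (hbot (a := 2⁻¹) (by norm_num)), hf.comp (htop (a := 2⁻¹) (by norm_num))⟩
    have := (isIntegralCurveOn_univ.1 (isHamiltonCurveOn_iff.1 h)).comp_mul 2⁻¹
    rw [hamiltonField_cometric] at this
    refine isIntegralCurveOn_univ.2 fun s => ?_
    have hs := this s
    simp only [Function.comp_def, Pi.smul_apply, smul_smul, inv_mul_cancel₀ (two_ne_zero' ℝ),
      one_smul] at hs
    exact hs
  · rintro ⟨t, z, ζ, ⟨h, h1⟩, hb, hf⟩
    refine ⟨t, _, _, ⟨isHamiltonCurveOn_iff.2 ?_, fun s => h1 (s * 2) trivial⟩,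
      hb.comp (hbot (a := 2) (by norm_num)), hf.comp (htop (a := 2) (by norm_num))⟩
    have := (isIntegralCurveOn_univ.1 (isHamiltonCurveOn_iff.1 h)).comp_mul 2
    rw [hamiltonField_cometric]
    exact isIntegralCurveOn_univ.2 this

/-- Near its backward endpoint, a geodesic is a straight line that the endpoint determines up to
translation along itself. -/
theorem IsLiftedGeodesicOn.exists_line_of_tendsToBackward (h : g.IsLiftedGeodesicOn t univ z ζ)
    (hflat : g.IsFlatOutside T R) (hR : 0 < R) {q : OneCuspBoundary n}
    (hq : TendsToBackward t z ζ q) :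
    ∃ (c : E n) (s₀ : ℝ), c - inner ℝ c q.y • q.y = -q.η ∧
      ∀ s ≤ s₀, z s = c + s • q.y ∧ ζ s = q.y := by
  obtain ⟨s₀, hs₀⟩ := eventually_atBot.1 (hq.1.eventually_ge_atTop R)
  have hl := (h.mono (subset_univ (Iic s₀))).eq_line_of_outside hflat hR hs₀ (self_mem_Iic (a := s₀))
  have hy : ζ s₀ = q.y := by
    refine tendsto_nhds_unique (tendsto_const_nhds.congr' ?_) hq.2.1
    filter_upwards [eventually_le_atBot s₀] with s hs using (hl s hs).2.symm
  have hline : ∀ s ≤ s₀, z s = (z s₀ - s₀ • q.y) + s • q.y ∧ ζ s = q.y := fun s hs => by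
    refine ⟨?_, (hl s hs).2.trans hy⟩
    rw [(hl s hs).1, hy, sub_smul]
    abel
  refine ⟨_, s₀, ?_, hline⟩
  have := (tendsToBackward_of_line (t := t) q.norm_y hline).2.2.2
  rw [lineEndpoint, neg_neg] at this
  exact tendsto_nhds_unique this hq.2.2.2

/-- The backward endpoint fixes the time slice and the incoming line. Two geodesics on that line
differ there by a shift of the parameter, hence everywhere, and a shift does not change the forward
endpoint. -/
theorem IsFlatOutside.classicalScattering_unique (hflat : g.IsFlatOutside T R) (hR : 0 < R)
    {q q₁ q₂ : OneCuspBoundary n} (h₁ : g.ClassicalScattering q q₁)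
    (h₂ : g.ClassicalScattering q q₂) : q₁ = q₂ := by
  obtain ⟨t, z, ζ, h, hb, hf⟩ := classicalScattering_iff.1 h₁
  obtain ⟨t', z', ζ', h', hb', hf'⟩ := classicalScattering_iff.1 h₂
  obtain rfl : t = t' := by linarith [hb.2.2.1, hb'.2.2.1]
  obtain ⟨c, s₀, hc, hl⟩ := h.exists_line_of_tendsToBackward hflat hR hb
  obtain ⟨c', s₀', hc', hl'⟩ := h'.exists_line_of_tendsToBackward hflat hR hb'
  set σ : ℝ := inner ℝ c q.y - inner ℝ c' q.y with hσ
  have hcc : c = c' + σ • q.y := by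
    rw [hσ, sub_smul, ← sub_eq_zero]
    have := sub_eq_zero.2 (hc.trans hc'.symm)
    rw [← this]
    abel
  have hshift : g.IsLiftedGeodesicOn t univ (z' ∘ (· + σ)) (ζ' ∘ (· + σ)) :=
    ⟨isHamiltonCurveOn_iff.2 (isIntegralCurveOn_univ.2
      ((isIntegralCurveOn_univ.1 h'.isIntegralCurveOn).comp_add σ)), fun s _ => h'.2 _ trivial⟩
  -- The comparison time is early enough for both curves to be on their straight parts.
  have heq := h.eqOn hshift (mem_univ (min s₀ (s₀' - σ))) (by
    set s := min s₀ (s₀' - σ)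
    have h1 := hl s (min_le_left _ _)
    have h2 := hl' (s + σ) (by linarith [min_le_right s₀ (s₀' - σ)])
    simp only [Function.comp_apply, h1, h2, hcc, add_smul]
    congr 1
    abel)
  have hf'' := hf'.comp (tendsto_atTop_add_const_right atTop σ tendsto_id)
  have hz : z' ∘ (· + σ) = z := funext fun s => (Prod.ext_iff.1 (heq s trivial)).1.symm
  have hζ : ζ' ∘ (· + σ) = ζ := funext fun s => (Prod.ext_iff.1 (heq s trivial)).2.symm
  refine hf.unique (q' := q₂) ?_
  rw [← hz, ← hζ]
  exact hf''

/-- Both geodesics agree up to the shorter exit time; were it strictly shorter, the other one would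
be on the sphere while still inside the open ball. -/
theorem truncatedScattering_unique {p : InwardBoundary n T R} {p₁ p₂ : OutwardBoundary n T R}
    (h₁ : g.TruncatedScattering T R p p₁) (h₂ : g.TruncatedScattering T R p p₂) : p₁ = p₂ := by
  have key : ∀ {p₁ p₂ : OutwardBoundary n T R} {ℓ ℓ' : ℝ} {z ζ z' ζ' : ℝ → E n}, 0 < ℓ → ℓ ≤ ℓ' →
      p₁.1.1 = p.1.1 → p₂.1.1 = p.1.1 →
      g.IsLiftedGeodesicOn p.1.1 (Icc 0 ℓ) z ζ → g.IsLiftedGeodesicOn p.1.1 (Icc 0 ℓ') z' ζ' →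
      (z 0, ζ 0) = p.1.2 → (z' 0, ζ' 0) = p.1.2 → (z ℓ, ζ ℓ) = p₁.1.2 → (z' ℓ', ζ' ℓ') = p₂.1.2 →
      (∀ s ∈ Ioo 0 ℓ', ‖z' s‖ < R) → p₁ = p₂ := by
    intro p₁ p₂ ℓ ℓ' z ζ z' ζ' hℓ hle ht₁ ht₂ h h' h0 h0' hp₁ hp₂ hin
    have heq := h.eqOn (h'.mono (Icc_subset_Icc_right hle)) (left_mem_Icc.2 hℓ.le)
      (h0.trans h0'.symm) ℓ (right_mem_Icc.2 hℓ.le)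
    obtain rfl : ℓ = ℓ' := by
      by_contra hne
      have := hin ℓ ⟨hℓ, lt_of_le_of_ne hle hne⟩
      have hz : z ℓ = z' ℓ := congrArg Prod.fst heq
      have hz₁ : z ℓ = p₁.1.2.1 := congrArg Prod.fst hp₁
      rw [← hz, hz₁] at this
      exact this.ne p₁.2.2.1
    exact Subtype.ext (Prod.ext (ht₁.trans ht₂.symm) (hp₁.symm.trans (heq.trans hp₂)))
  obtain ⟨ht₁, ℓ, hℓ, z, ζ, h, h0, hp₁, hin⟩ := h₁
  obtain ⟨ht₂, ℓ', hℓ', z', ζ', h', h0', hp₂, hin'⟩ := h₂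
  rcases le_total ℓ ℓ' with hle | hle
  · exact key hℓ hle ht₁ ht₂ h h' h0 h0' hp₁ hp₂ hin'
  · exact (key hℓ' hle ht₂ ht₁ h' h h0' h0 hp₂ hp₁ hin).symm

/-- A curve that starts inward from the sphere of radius `R` and later leaves the ball has a first
exit time. -/
theorem exists_first_exit {F : Type*} [NormedAddCommGroup F] [InnerProductSpace ℝ F] {z : ℝ → F}
    {v : F} {R : ℝ} (hz : Continuous z) (hd : HasDerivAt z v 0) (h0 : ‖z 0‖ = R)
    (hin : inner ℝ (z 0) v < 0) (hex : ∃ s > 0, R < ‖z s‖) :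
    ∃ ℓ > 0, ‖z ℓ‖ = R ∧ ∀ s ∈ Ioo 0 ℓ, ‖z s‖ < R := by
  have hsmall : ∀ᶠ s in 𝓝[>] (0 : ℝ), ‖z s‖ < R := by
    have hslope := (hasDerivAt_iff_tendsto_slope.1 hd.norm_sq).mono_left
      (nhdsWithin_mono 0 (fun s (hs : 0 < s) => hs.ne'))
    filter_upwards [hslope.eventually_lt_const (by linarith : 2 * inner ℝ (z 0) v < 0),
      self_mem_nhdsWithin] with s hs hpos
    have hpos : (0 : ℝ) < s := hpos
    rw [slope_def_field, sub_zero, div_neg_iff] at hs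
    have hs' : ‖z s‖ ^ 2 < ‖z 0‖ ^ 2 := by
      rcases hs with ⟨_, hs⟩ | ⟨hs, _⟩ <;> linarith
    rw [h0] at hs'
    exact lt_of_pow_lt_pow_left₀ 2 (h0 ▸ norm_nonneg _) hs'
  obtain ⟨δ, hδ, hδs⟩ := mem_nhdsGT_iff_exists_Ioo_subset.1 hsmall
  have hδ : 0 < δ := hδ
  obtain ⟨s₁, hs₁, hs₁R⟩ := hex
  have hlt : ∀ s ∈ Ioo 0 δ, ‖z s‖ < R := fun s hs => hδs hs
  -- Times below `δ` are excluded because the curve also lies on the sphere at time 0.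
  have hcl : IsClosed {s | δ ≤ s ∧ R ≤ ‖z s‖} :=
    isClosed_Ici.inter (isClosed_le continuous_const hz.norm)
  have hne : {s | δ ≤ s ∧ R ≤ ‖z s‖}.Nonempty :=
    ⟨s₁, le_of_not_gt fun h => (hlt s₁ ⟨hs₁, h⟩).not_gt hs₁R, hs₁R.le⟩
  have hbdd : BddBelow {s | δ ≤ s ∧ R ≤ ‖z s‖} := ⟨δ, fun s hs => hs.1⟩
  have hmem := hcl.csInf_mem hne hbdd
  set ℓ := sInf {s | δ ≤ s ∧ R ≤ ‖z s‖}
  have hℓ : 0 < ℓ := hδ.trans_le hmem.1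
  have hbefore : ∀ s ∈ Ioo 0 ℓ, ‖z s‖ < R := fun s hs => by
    by_contra hge
    rcases lt_or_ge s δ with h | h
    · exact hge (hlt s ⟨hs.1, h⟩)
    · exact hs.2.not_ge (csInf_le hbdd ⟨h, not_lt.1 hge⟩)
  refine ⟨ℓ, hℓ, le_antisymm ?_ hmem.2, hbefore⟩
  refine le_of_tendsto (hz.norm.continuousWithinAt (s := Iio ℓ) (x := ℓ)) ?_
  filter_upwards [Ioo_mem_nhdsLT hℓ] with s hs using (hbefore s hs).le

/-- A geodesic that enters the ball `B_R(0)` leaves it again, transversally, and the endpoints of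
its two half-lines outside the ball are related by the classical scattering map. -/
theorem IsFlatOutside.exists_scattering (hflat : g.IsFlatOutside T R) (hR : 0 < R)
    (hnt : g.NonTrapping) (p : InwardBoundary n T R) :
    ∃ p' : OutwardBoundary n T R, g.TruncatedScattering T R p p' ∧
      g.ClassicalScattering (lineEndpoint p.1.1 p.1.2.1 p.1.2.2 p.2.2.2.1)
        (lineEndpoint p'.1.1 p'.1.2.1 p'.1.2.2 p'.2.2.2.1) := by
  obtain ⟨⟨t, z₀, v₀⟩, ht, hz₀, hv₀, hin⟩ := p
  simp only at ht hz₀ hv₀ hin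
  obtain ⟨z, ζ, hz0, hζ0, h⟩ := hflat.exists_isLiftedGeodesicOn_univ t hR (z₀ := z₀) (ζ₀ := v₀)
    (by rw [hflat.cometric_eq t hz₀.ge, hv₀, one_pow])
  have hγ := isIntegralCurveOn_univ.1 h.isIntegralCurveOn
  have hcont : Continuous z := continuous_fst.comp hγ.continuous
  have hd : HasDerivAt z v₀ 0 := by
    have : HasDerivAt (fun s => (z s, ζ s)) (g.geodesicField t (z 0, ζ 0)) 0 := hγ 0
    rw [hflat.geodesicField_eq t hR (p := (z 0, ζ 0)) (by rw [hz0, hz₀]), hζ0] at this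
    exact (hasFDerivAt_fst (p := (z 0, ζ 0))).comp_hasDerivAt 0 this
  obtain ⟨s₁, hs₁, hs₁K⟩ := hnt t z ζ h _ (isCompact_closedBall 0 R)
  obtain ⟨ℓ, hℓ, hzℓ, hbefore⟩ := exists_first_exit hcont hd (hz0 ▸ hz₀) (hz0 ▸ hin)
    ⟨s₁, hs₁, by simpa using hs₁K⟩
  have hζℓ : ‖ζ ℓ‖ = 1 := by
    have := h.2 ℓ trivial
    rw [hflat.cometric_eq t hzℓ.ge] at this
    exact (pow_eq_one_iff_of_nonneg (norm_nonneg _) two_ne_zero).1 this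
  -- If the exit were tangential or inward, the line traced backward from `z ℓ` would stay outside
  -- the open ball and so be the geodesic itself, which at time `ℓ / 2` is inside.
  have hout : 0 < inner ℝ (z ℓ) (ζ ℓ) := by
    by_contra hle
    have hline := (h.mono (subset_univ (Iic ℓ))).eq_line_of_line_outside hflat hR
      (self_mem_Iic (a := ℓ)) (fun s hs => hzℓ ▸ le_norm_add_smul hζℓ
        (mul_nonneg_of_nonpos_of_nonpos (sub_nonpos.2 hs) (not_lt.1 hle)))
    have hlt := hbefore (ℓ / 2) ⟨by linarith, by linarith⟩
    rw [(hline (ℓ / 2) (by simp; linarith)).1] at hlt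
    refine hlt.not_ge (hzℓ ▸ le_norm_add_smul hζℓ ?_)
    exact mul_nonneg_of_nonpos_of_nonpos (by linarith) (not_lt.1 hle)
  have hback := (h.mono (subset_univ (Iic 0))).eq_line_of_line_outside hflat hR
    (self_mem_Iic (a := (0 : ℝ))) (fun s hs => by
      rw [hz0, hζ0, ← hz₀]
      exact le_norm_add_smul hv₀ (mul_nonneg_of_nonpos_of_nonpos (sub_nonpos.2 hs) hin.le))
  have hforw := (h.mono (subset_univ (Ici ℓ))).eq_line_of_line_outside hflat hR
    (self_mem_Ici (a := ℓ)) (fun s hs => hzℓ ▸ le_norm_add_smul hζℓ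
      (mul_nonneg (sub_nonneg.2 hs) hout.le))
  refine ⟨⟨(t, z ℓ, ζ ℓ), ht, hzℓ, hζℓ, hout⟩,
    ⟨rfl, ℓ, hℓ, z, ζ, h.mono (subset_univ _), by simp [hz0, hζ0], rfl, hbefore⟩,
    classicalScattering_iff.2 ⟨t, z, ζ, h, tendsToBackward_of_line hv₀ (s₀ := 0) ?_, ?_⟩⟩
  · intro s hs
    simpa [hz0, hζ0] using hback s hs
  · have hshift : TendsToForward t (z ∘ (· + ℓ)) (ζ ∘ (· + ℓ)) (lineEndpoint t (z ℓ) (ζ ℓ) hζℓ) :=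
      tendsToForward_of_line hζℓ (s₀ := 0) fun s hs => by
        simpa using hforw (s + ℓ) (by simpa using hs)
    simpa [Function.comp_def] using
      hshift.comp (tendsto_atTop_add_const_right atTop (-ℓ) tendsto_id)

end MetricFamily

theorem mainTheorem5 {n : ℕ} (T R : ℝ) (hT : 0 < T) (hR : 0 < R) (g₁ g₂ : MetricFamily n)
    (hflat₁ : g₁.IsFlatOutside T R) (hflat₂ : g₂.IsFlatOutside T R)
    (hnt₁ : g₁.NonTrapping) (hnt₂ : g₂.NonTrapping)
    (hCl : ∀ q q' : OneCuspBoundary n,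
      g₁.ClassicalScattering q q' ↔ g₂.ClassicalScattering q q') :
    ∃ ClR : InwardBoundary n T R → OutwardBoundary n T R,
      (∀ p p', g₁.TruncatedScattering T R p p' ↔ p' = ClR p) ∧
      (∀ p p', g₂.TruncatedScattering T R p p' ↔ p' = ClR p) := by
  choose f₁ hf₁ hc₁ using hflat₁.exists_scattering hR hnt₁
  choose f₂ hf₂ hc₂ using hflat₂.exists_scattering hR hnt₂
  have hf : ∀ p, f₁ p = f₂ p := fun p => by
    -- Both metrics share the incoming endpoint, since it depends on `p` only.
    have hq := hflat₂.classicalScattering_unique hR ((hCl _ _).1 (hc₁ p)) (hc₂ p)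
    obtain ⟨hz, hv⟩ := eq_of_lineEndpoint_eq (f₁ p).2.2.1 (f₂ p).2.2.1 (f₁ p).2.2.2.2
      (f₂ p).2.2.2.2 hq
    exact Subtype.ext (Prod.ext ((hf₁ p).1.trans (hf₂ p).1.symm) (Prod.ext hz hv))
  refine ⟨f₁, fun p p' => ⟨fun h => MetricFamily.truncatedScattering_unique h (hf₁ p), ?_⟩,
    fun p p' => ⟨fun h => hf p ▸ MetricFamily.truncatedScattering_unique h (hf₂ p), ?_⟩⟩
  · rintro rfl
    exact hf₁ p
  · rintro rfl
    exact hf p ▸ hf₂ p
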